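/- **Setting.** For a $2^n\times 2^n$ Hermitian matrix $H$ let $\|H\|_{\max}$ be the largest absolute value of an entry; $H$ is *$d$-sparse* if every row has at most $d$ nonzero entries. An algorithm accesses $H$ through a black box that answers two kinds of queries, $|j,k,z\rangle\mapsto|j,k,z\oplus \mathrm{enc}(H_{jk})\rangle$, where $\mathrm{enc}$ represents entries by bit strings of some length $b$, and $|j,\ell\rangle\mapsto|j,f(j,\ell)\rangle$ or its inverse. Here $f(j,\cdot)$ is a permutation of the $2^n$ columns that is determined by $j$ and the $j$th row of $H$ through a fixed listing convention, and the columns $f(j,1),\dots,f(j,d)$ include all those in which row $j$ is nonzero. An algorithm with $q$ queries appends an ancilla in a fixed state, applies arbitrary unitaries independent of $H$ interleaved with $q$ (possibly controlled) queries, and discards the ancilla; it *simulates $H$ for time $t$ with precision $\epsilon$* if the resulting channel is within diamond norm distance $\epsilon$ of $\rho\mapsto e^{-iHt}\rho e^{iHt}$. For an integer $d\ge 2$ and $h,t,\epsilon>0$, say that *simulation requires $B$ queries* if for some $n$ with $2^n\ge d$ there is a finite family of $d$-sparse Hamiltonians $H$ on $n$ qubits with $\|H\|_{\max}=h$ such that,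 for every $b$, every encoding of entries by $b$-bit strings and every listing convention, each algorithm with fewer than $B$ queries fails to simulate some $H$ of the family for time $t$ with precision $\epsilon$. Put $\tau:=d\,h\,t$. **Theorem.** There is an absolute constant $c>0$ with the following two properties. 1. For every $\tau_0>0$ there is $\epsilon_0\in(0,1/e)$ such that for every integer $d\ge2$ and all $h,t>0$ and $0<\epsilon\le\epsilon_0$ with $\tau\ge\tau_0$, simulation requires $$c\left(\tau+\frac{\log(1/\epsilon)}{\log\log(1/\epsilon)}\right)$$ queries. 2. For every integer $d\ge2$ and all $h,t>0$ and $0<\epsilon<1$ with $c\,\tau\ge1$, simulation requires $c\,\tau$ queries. In short, simulating $d$-sparse Hamiltonians with a prescribed value of $\|H\|_{\max}$ takes $\Omega\bigl(\tau+\frac{\log(1/\epsilon)}{\log\log(1/\epsilon)}\bigr)$ queries in the worst case, in the sense of items 1 and 2. -/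

import Mathlib

open scoped ENNReal Kronecker

namespace HamSim

noncomputable section

/-! ### Hamiltonians -/

/-- A matrix is `d`-sparse if every row has at most `d` nonzero entries. -/
def IsSparse {ι : Type} [Fintype ι] (d : ℕ) (H : Matrix ι ι ℂ) : Prop :=
  ∀ j, {k | H j k ≠ 0}.ncard ≤ d

/-- The largest absolute value of an entry. -/
def maxNorm {ι : Type} [Fintype ι] (H : Matrix ι ι ℂ) : ℝ :=
  ⨆ p : ι × ι, ‖H p.1 p.2‖

/-- The unitary evolution `exp (-i H t)`. -/
def evolution {ι : Type} [Fintype ι] [DecidableEq ι] (H : Matrix ι ι ℂ) (t : ℝ) :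
    Matrix ι ι ℂ :=
  NormedSpace.exp ((-(Complex.I * (t : ℂ))) • H)

/-! ### Superoperators and the diamond norm -/

/-- The trace norm: the sum of the singular values, i.e. of the square roots of the eigenvalues
of `Aᴴ A`. -/
def traceNorm {ι : Type} [Fintype ι] [DecidableEq ι] (A : Matrix ι ι ℂ) : ℝ :=
  ∑ i, √((Matrix.isHermitian_conjTranspose_mul_self A).eigenvalues i)

/-- `Φ ⊗ id`, where the identity acts on an `r`-dimensional reference system. -/
def tensorId {ι : Type} (r : ℕ) (Φ : Matrix ι ι ℂ → Matrix ι ι ℂ)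
    (X : Matrix (ι × Fin r) (ι × Fin r) ℂ) : Matrix (ι × Fin r) (ι × Fin r) ℂ :=
  Matrix.of fun a b => Φ (Matrix.of fun s s' => X (s, a.2) (s', b.2)) a.1 b.1

/-- The diamond norm of a (linear) map on matrices: the supremum, over all reference systems, of
the operator norm of `Φ ⊗ id` with respect to the trace norm. -/
def diamondNorm {ι : Type} [Fintype ι] [DecidableEq ι] (Φ : Matrix ι ι ℂ → Matrix ι ι ℂ) :
    ℝ≥0∞ :=
  ⨆ (r : ℕ) (X : Matrix (ι × Fin r) (ι × Fin r) ℂ) (_ : traceNorm X ≤ 1),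
    ENNReal.ofReal (traceNorm (tensorId r Φ X))

/-- Conjugation `ρ ↦ V ρ Vᴴ`. -/
def conjBy {ι : Type} [Fintype ι] (V ρ : Matrix ι ι ℂ) : Matrix ι ι ℂ :=
  V * ρ * V.conjTranspose

/-- Partial trace over the second tensor factor. -/
def partialTrace {ι κ : Type} [Fintype κ] (X : Matrix (ι × κ) (ι × κ) ℂ) : Matrix ι ι ℂ :=
  Matrix.of fun s s' => ∑ a, X (s, a) (s', a)

/-! ### The black box for a sparse Hamiltonian -/

/-- A convention for enumerating the nonzero entries of the rows of a `d`-sparse matrix. In row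
`j`, with content `v`, the `ℓ`-th listed column is `col j v ℓ`; the first `d` listed columns
include all columns with a nonzero entry. Since the black box acts in place, the list is continued
to a permutation of all columns. -/
structure ListingRule (n d : ℕ) where
  col : Fin (2 ^ n) → (Fin (2 ^ n) → ℂ) → Equiv.Perm (Fin (2 ^ n))
  lists_nonzero : ∀ j v, {k | v k ≠ 0}.ncard ≤ d → ∀ k, v k ≠ 0 →
    ∃ ℓ : Fin (2 ^ n), (ℓ : ℕ) < d ∧ col j v ℓ = k

/-- The ancilla of an algorithm: an index register `j`, an index register `k`, a register `z` of
`b` bits, a four-valued register that selects the query, and `w` work qubits. -/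
abbrev Ancilla (n b w : ℕ) : Type :=
  Fin (2 ^ n) × Fin (2 ^ n) × (Fin b → Bool) × Fin 4 × Fin (2 ^ w)

/-- The initial basis state of the ancilla. -/
def ancillaZero (n b w : ℕ) : Ancilla n b w :=
  (0, 0, fun _ => false, 0, 0)

/-- The action of one query on basis states. According to the select register this is the
identity, the map `|j, k, z⟩ ↦ |j, k, z ⊕ H j k⟩`, the map `|j, ℓ⟩ ↦ |j, f (j, ℓ)⟩`, or the inverse
of the latter. Entries are represented as bit strings through `enc`. -/
def queryMap {n d b w : ℕ} (enc : ℂ → Fin b → Bool) (f : ListingRule n d)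
    (H : Matrix (Fin (2 ^ n)) (Fin (2 ^ n)) ℂ) :
    Fin (2 ^ n) × Ancilla n b w → Fin (2 ^ n) × Ancilla n b w
  | (s, j, k, z, 0, a) => (s, j, k, z, 0, a)
  | (s, j, k, z, 1, a) => (s, j, k, fun i => xor (z i) (enc (H j k) i), 1, a)
  | (s, j, k, z, 2, a) => (s, j, f.col j (H j) k, z, 2, a)
  | (s, j, k, z, 3, a) => (s, j, (f.col j (H j)).symm k, z, 3, a)

/-- The unitary matrix of one query. -/
def queryMatrix {n d b : ℕ} (w : ℕ) (enc : ℂ → Fin b → Bool) (f : ListingRule n d)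
    (H : Matrix (Fin (2 ^ n)) (Fin (2 ^ n)) ℂ) :
    Matrix (Fin (2 ^ n) × Ancilla n b w) (Fin (2 ^ n) × Ancilla n b w) ℂ :=
  Matrix.of fun x y => if x = queryMap enc f H y then 1 else 0

/-! ### Query algorithms -/

/-- A quantum query algorithm on an `n`-qubit system, for entries of `b` bits: arbitrary unitaries
`gate 0, …, gate queries`, which do not depend on the black box, interleaved with `queries`
queries. -/
structure QueryAlgorithm (n b : ℕ) where
  queries : ℕ
  work : ℕ
  gate : Fin (queries + 1) → Matrix.unitaryGroup (Fin (2 ^ n) × Ancilla n b work) ℂ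

/-- The product `gate i * O * gate (i - 1) * O * ⋯ * O * gate 0` for the query matrix `O`. -/
def QueryAlgorithm.run {n b : ℕ} (A : QueryAlgorithm n b)
    (O : Matrix (Fin (2 ^ n) × Ancilla n b A.work) (Fin (2 ^ n) × Ancilla n b A.work) ℂ) :
    Fin (A.queries + 1) →
      Matrix (Fin (2 ^ n) × Ancilla n b A.work) (Fin (2 ^ n) × Ancilla n b A.work) ℂ :=
  fun i => Fin.induction (motive := fun _ =>
      Matrix (Fin (2 ^ n) × Ancilla n b A.work) (Fin (2 ^ n) × Ancilla n b A.work) ℂ)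
    (A.gate 0).1 (fun i V => (A.gate i.succ).1 * O * V) i

/-- The operation that the algorithm performs on the system: append the ancilla in its initial
state, run the algorithm, and trace out the ancilla. -/
def QueryAlgorithm.channel {n b d : ℕ} (A : QueryAlgorithm n b) (enc : ℂ → Fin b → Bool)
    (f : ListingRule n d) (H ρ : Matrix (Fin (2 ^ n)) (Fin (2 ^ n)) ℂ) :
    Matrix (Fin (2 ^ n)) (Fin (2 ^ n)) ℂ :=
  partialTrace (conjBy (A.run (queryMatrix A.work enc f H) (Fin.last A.queries))
    (ρ ⊗ₖ Matrix.single (ancillaZero n b A.work) (ancillaZero n b A.work) (1 : ℂ)))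

/-- With the black box for `H`, the algorithm performs `exp (-i H t)` up to diamond norm
distance `ε`. -/
def QueryAlgorithm.Simulates {n b d : ℕ} (A : QueryAlgorithm n b) (enc : ℂ → Fin b → Bool)
    (f : ListingRule n d) (H : Matrix (Fin (2 ^ n)) (Fin (2 ^ n)) ℂ) (t ε : ℝ) : Prop :=
  diamondNorm (fun ρ => A.channel enc f H ρ - conjBy (evolution H t) ρ) ≤ ENNReal.ofReal ε

/-- At least `B` queries are needed, in the worst case, to simulate `d`-sparse Hamiltonians with
largest entry `h` in absolute value for time `t` to precision `ε`: for some number `n` of qubits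
there is a finite family of such Hamiltonians so that, whatever the representation of the entries
by bit strings and the convention for listing the nonzero entries of a row, every algorithm with
fewer than `B` queries fails on a Hamiltonian of the family. -/
def RequiresQueries (d : ℕ) (h t ε B : ℝ) : Prop :=
  ∃ n : ℕ, d ≤ 2 ^ n ∧ ∃ 𝓗 : Set (Matrix (Fin (2 ^ n)) (Fin (2 ^ n)) ℂ), 𝓗.Finite ∧
    (∀ H ∈ 𝓗, H.IsHermitian ∧ IsSparse d H ∧ maxNorm H = h) ∧
    ∀ (b : ℕ) (enc : ℂ → Fin b → Bool) (f : ListingRule n d) (A : QueryAlgorithm n b),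
      (A.queries : ℝ) < B → ∃ H ∈ 𝓗, ¬ A.Simulates enc f H t ε

end

end HamSim

namespace HamSim

/-! ### Functions of low degree on the Boolean cube -/

/-! The proof reduces parity to simulation. On a path with sites `0, …, N` put the weights
√((k+1)(N-k)), those of a rotating spin `N / 2`, and give edge `k` the sign (-1)^(x k). A diagonal
change of signs removes the edge signs except for their product, so a particle that starts at site
`0` is at site `N`, after angle θ, with amplitude parity(x) · (-i sin θ)^N. Replacing each site by
⌊d/2⌋ copies uses up the sparsity and speeds up the walk by that factor. Of the added isolated
vertices, one has energy `h` and fixes the max norm; another has energy zero and serves as a phase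
reference `r`. The coherence between the moving state and `r` exposes the amplitude itself, which is
linear in the output of the channel.

Each row depends on at most two bits, so after `q` queries every entry of the output has degree at
most `4 q` in x (`channel_mem_lowDegree`). If `4 q < N`, this is orthogonal to the parity character,
and averaging against parity gives |sin θ|^N ≤ ε. Hence `requiresQueries_of_lt_sin_pow`: whenever
|sin θ|^N > ε and the max norm permits angle θ in time `t`, at least `N / 4` queries are needed.
Taking θ = π/2 and `N` of order τ gives the bound in τ for every ε < 1; taking θ of order `1 / N`
and `N` of order log(1/ε)/log log(1/ε) gives the bound in ε, even for short times. -/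

/-- The functions on the Boolean cube of degree at most `D`, as the span of the functions that
depend on at most `D` coordinates. -/
noncomputable def lowDegree (N D : ℕ) : Submodule ℂ ((Fin N → Bool) → ℂ) :=
  Submodule.span ℂ {g | ∃ S : Finset (Fin N), S.card ≤ D ∧ DependsOn g S}

theorem mem_lowDegree_of_dependsOn {N D : ℕ} {g : (Fin N → Bool) → ℂ} (S : Finset (Fin N))
    (hS : S.card ≤ D) (hg : DependsOn g S) : g ∈ lowDegree N D :=
  Submodule.subset_span ⟨S, hS, hg⟩

theorem const_mem_lowDegree {N D : ℕ} (a : ℂ) : (fun _ => a) ∈ lowDegree N D :=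
  mem_lowDegree_of_dependsOn ∅ (by simp) (fun _ _ _ => rfl)

/-- A product of two generators depends only on the union of their coordinate sets; bilinearity does
the rest. -/
theorem mul_mem_lowDegree {N D E : ℕ} {f g : (Fin N → Bool) → ℂ} (hf : f ∈ lowDegree N D)
    (hg : g ∈ lowDegree N E) : (fun x => f x * g x) ∈ lowDegree N (D + E) := by
  have h := Submodule.mul_mem_mul hf hg
  rw [lowDegree, lowDegree, Submodule.span_mul_span] at h
  refine Submodule.span_mono ?_ h
  rintro _ ⟨f, ⟨S, hS, hf⟩, g, ⟨T, hT, hg⟩, rfl⟩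
  refine ⟨S ∪ T, (Finset.card_union_le S T).trans (add_le_add hS hT), fun x y hxy => ?_⟩
  have h1 : f x = f y := hf fun i hi => hxy i (by simp_all)
  have h2 : g x = g y := hg fun i hi => hxy i (by simp_all)
  simp [h1, h2]

theorem star_mem_lowDegree {N D : ℕ} {f : (Fin N → Bool) → ℂ} (hf : f ∈ lowDegree N D) :
    (fun x => star (f x)) ∈ lowDegree N D := by
  refine Submodule.span_induction (p := fun f _ => (fun x => star (f x)) ∈ lowDegree N D)
    ?_ ?_ ?_ ?_ hf
  · rintro f ⟨S, hS, h⟩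
    exact mem_lowDegree_of_dependsOn S hS fun x y hxy => by simp [h hxy]
  · simpa using const_mem_lowDegree (N := N) (D := D) 0
  · intro f g _ _ hf hg
    simpa [Pi.add_def] using (lowDegree N D).add_mem hf hg
  · intro a f _ hf
    simpa [Pi.smul_def] using (lowDegree N D).smul_mem (star a) hf

theorem sum_mem_lowDegree {N D : ℕ} {α : Type*} (s : Finset α) {f : α → (Fin N → Bool) → ℂ}
    (hf : ∀ a, f a ∈ lowDegree N D) : (fun x => ∑ a ∈ s, f a x) ∈ lowDegree N D := by
  have := (lowDegree N D).sum_mem (t := s) (f := f) fun a _ => hf a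
  convert this using 1
  ext x
  simp

/-- The sign `(-1) ^ b` of a bit. -/
def bitSign (b : Bool) : ℝ := if b then -1 else 1

theorem bitSign_not (b : Bool) : bitSign (!b) = -bitSign b := by
  cases b <;> simp [bitSign]

theorem abs_bitSign (b : Bool) : |bitSign b| = 1 := by
  cases b <;> simp [bitSign]

/-- The parity character `(-1) ^ (x 0 + ⋯ + x (N - 1))`. -/
noncomputable def paritySign {N : ℕ} (x : Fin N → Bool) : ℝ := ∏ i, bitSign (x i)

theorem paritySign_update_not {N : ℕ} (x : Fin N → Bool) (i : Fin N) :
    paritySign (Function.update x i (!x i)) = -paritySign x := by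
  have h : (fun j => bitSign (Function.update x i (!x i) j))
      = Function.update (fun j => bitSign (x j)) i (-bitSign (x i)) := by
    ext j
    rcases eq_or_ne j i with rfl | hj
    · simp [bitSign_not]
    · simp [hj]
  rw [paritySign, h, Finset.prod_update_of_mem (Finset.mem_univ i), paritySign,
    ← Finset.prod_sdiff (Finset.subset_univ {i})]
  simp [mul_comm]

theorem abs_paritySign {N : ℕ} (x : Fin N → Bool) : |paritySign x| = 1 := by
  simp [paritySign, Finset.abs_prod, abs_bitSign]

/-- The parity character is orthogonal to all functions of degree less than the number of bits. -/
theorem sum_paritySign_mul_eq_zero {N D : ℕ} (hD : D < N) {f : (Fin N → Bool) → ℂ}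
    (hf : f ∈ lowDegree N D) : ∑ x, (paritySign x : ℂ) * f x = 0 := by
  refine Submodule.span_induction (p := fun f _ => ∑ x, (paritySign x : ℂ) * f x = 0)
    ?_ ?_ ?_ ?_ hf
  · rintro f ⟨S, hS, h⟩
    obtain ⟨i, hi⟩ : ∃ i, i ∉ S := by
      by_contra! hall
      have := Finset.card_le_card (fun i _ => hall i : Finset.univ ⊆ S)
      simp at this
      omega
    -- Flipping a bit outside `S` preserves `f` and reverses the parity sign, so the terms cancel in
    -- pairs.
    refine Finset.sum_involution (fun x _ => Function.update x i (!x i)) ?_ ?_ ?_ ?_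
    · intro x _
      have : f (Function.update x i (!x i)) = f x := h fun j hj => by
        rw [Function.update_of_ne]
        rintro rfl
        exact hi hj
      rw [this, paritySign_update_not]
      push_cast
      ring
    · intro x _ _ hx
      simpa using congrFun hx i
    · simp
    · simp
  · simp
  · intro f g _ _ hf hg
    simp [mul_add, Finset.sum_add_distrib, hf, hg]
  · intro a f _ hf
    simp only [Pi.smul_apply, smul_eq_mul, mul_left_comm _ a, ← Finset.mul_sum, hf, mul_zero]

/-! ### The polynomial method -/

/-- On a basis state with index `j`, both an entry query and a listing query look only at row `j`;
this is why neither the encoding nor the listing convention matters. -/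
theorem queryMap_congr {n d b w : ℕ} (enc : ℂ → Fin b → Bool) (f : ListingRule n d)
    {H H' : Matrix (Fin (2 ^ n)) (Fin (2 ^ n)) ℂ} (y : Fin (2 ^ n) × Ancilla n b w)
    (h : H y.2.1 = H' y.2.1) : queryMap enc f H y = queryMap enc f H' y := by
  obtain ⟨s, j, k, z, q, a⟩ := y
  simp only at h
  fin_cases q <;> simp [queryMap, h]

section

variable {N n d b r : ℕ} (enc : ℂ → Fin b → Bool) (f : ListingRule n d)
  {H : (Fin N → Bool) → Matrix (Fin (2 ^ n)) (Fin (2 ^ n)) ℂ}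

theorem queryMatrix_mem_lowDegree (w : ℕ)
    (hH : ∀ j, ∃ S : Finset (Fin N), S.card ≤ r ∧ DependsOn (fun x => H x j) S)
    (y y' : Fin (2 ^ n) × Ancilla n b w) :
    (fun x => queryMatrix w enc f (H x) y y') ∈ lowDegree N r := by
  obtain ⟨S, hS, h⟩ := hH y'.2.1
  refine mem_lowDegree_of_dependsOn S hS fun x x' hx => ?_
  simp only [queryMatrix, Matrix.of_apply, queryMap_congr enc f y' (h hx)]

/-- The gates are constant in `x`, so only the queries raise the degree, each by at most `r`. -/
theorem run_mem_lowDegree (A : QueryAlgorithm n b)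
    (hH : ∀ j, ∃ S : Finset (Fin N), S.card ≤ r ∧ DependsOn (fun x => H x j) S)
    (i : Fin (A.queries + 1)) :
    ∀ y y', (fun x => A.run (queryMatrix A.work enc f (H x)) i y y')
      ∈ lowDegree N (r * (i : ℕ)) := by
  induction i using Fin.induction with
  | zero => exact fun y y' => const_mem_lowDegree _
  | succ i ih =>
    intro y y'
    have key : ∀ x, A.run (queryMatrix A.work enc f (H x)) i.succ y y'
        = ∑ u, (∑ v, (A.gate i.succ).1 y v * queryMatrix A.work enc f (H x) v u)
          * A.run (queryMatrix A.work enc f (H x)) i.castSucc u y' := fun x => rfl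
    simp only [key]
    refine sum_mem_lowDegree _ fun u => ?_
    have : r * ((i.succ : Fin _) : ℕ) = (0 + r) + r * ((i.castSucc : Fin _) : ℕ) := by
      simp
      ring
    rw [this]
    exact mul_mem_lowDegree (sum_mem_lowDegree _ fun v => mul_mem_lowDegree
      (const_mem_lowDegree _) (queryMatrix_mem_lowDegree enc f _ hH v u)) (ih u y')

theorem channel_mem_lowDegree (A : QueryAlgorithm n b)
    (hH : ∀ j, ∃ S : Finset (Fin N), S.card ≤ r ∧ DependsOn (fun x => H x j) S)
    (ρ : Matrix (Fin (2 ^ n)) (Fin (2 ^ n)) ℂ) (s s' : Fin (2 ^ n)) :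
    (fun x => A.channel enc f (H x) ρ s s') ∈ lowDegree N (2 * r * A.queries) := by
  have hV := run_mem_lowDegree enc f A hH (Fin.last A.queries)
  simp only [QueryAlgorithm.channel, partialTrace, conjBy, Matrix.of_apply]
  refine sum_mem_lowDegree _ fun a => ?_
  simp only [Matrix.mul_apply (M := _ * _), Matrix.mul_apply (M := A.run _ _),
    Matrix.conjTranspose_apply]
  refine sum_mem_lowDegree _ fun u => ?_
  -- The run and its adjoint each contribute `r * A.queries`; the input state contributes nothing.
  have : 2 * r * A.queries = (r * A.queries + 0) + r * A.queries := by ring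
  rw [this]
  exact mul_mem_lowDegree (sum_mem_lowDegree _ fun v => mul_mem_lowDegree (hV _ _)
    (const_mem_lowDegree _)) (star_mem_lowDegree (hV _ _))

end

/-! ### The trace norm and the diamond norm -/

section

variable {ι : Type} [Fintype ι] [DecidableEq ι]

/-- The left side is the trace of `Aᴴ A`, the sum of the squared singular values, and the ℓ² norm is
at most the ℓ¹ norm. -/
theorem sum_normSq_le_traceNorm_sq (A : Matrix ι ι ℂ) :
    ∑ i, ∑ j, ‖A i j‖ ^ 2 ≤ traceNorm A ^ 2 := by
  set hA := Matrix.isHermitian_conjTranspose_mul_self A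
  have hpos : ∀ i, 0 ≤ hA.eigenvalues i :=
    Matrix.eigenvalues_conjTranspose_mul_self_nonneg A
  have htr : ((∑ i, ∑ j, ‖A i j‖ ^ 2 : ℝ) : ℂ) = ∑ i, (hA.eigenvalues i : ℂ) := by
    have := hA.trace_eq_sum_eigenvalues
    simp only [Complex.coe_algebraMap] at this
    rw [← this, Matrix.trace, Finset.sum_comm]
    push_cast
    refine Finset.sum_congr rfl fun j _ => ?_
    simp only [Matrix.diag_apply, Matrix.mul_apply, Matrix.conjTranspose_apply]
    exact Finset.sum_congr rfl fun i _ => (Complex.conj_mul' (A i j)).symm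
  have htr' : ∑ i, ∑ j, ‖A i j‖ ^ 2 = ∑ i, √(hA.eigenvalues i) ^ 2 := by
    simp only [Real.sq_sqrt (hpos _)]
    exact_mod_cast htr
  rw [htr']
  exact Finset.sum_sq_le_sq_sum_of_nonneg fun i _ => Real.sqrt_nonneg _

/-- Eigenvalues equal to 0 or 1 are their own square roots. This serves to evaluate the trace norm
of `|φ⟩⟨r|`. -/
theorem traceNorm_eq_trace_of_isIdempotent (A : Matrix ι ι ℂ)
    (h : IsIdempotentElem (A.conjTranspose * A)) :
    (traceNorm A : ℂ) = (A.conjTranspose * A).trace := by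
  set hA := Matrix.isHermitian_conjTranspose_mul_self A
  have key : ∀ i, √(hA.eigenvalues i) = hA.eigenvalues i := by
    intro i
    have h1 := hA.mulVec_eigenvectorBasis i
    have h2 : hA.eigenvalues i * hA.eigenvalues i = hA.eigenvalues i := by
      set v : ι → ℂ := (hA.eigenvectorBasis i).ofLp
      have hv : v ≠ 0 := by
        intro hv
        have := hA.eigenvectorBasis.orthonormal.ne_zero i
        exact this (by ext j; exact congrFun hv j)
      have h3 : (A.conjTranspose * A).mulVec ((A.conjTranspose * A).mulVec v)
          = (A.conjTranspose * A).mulVec v := by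
        rw [Matrix.mulVec_mulVec, h.eq]
      rw [h1, Matrix.mulVec_smul, h1, smul_smul] at h3
      exact smul_left_injective ℝ hv h3
    rcases (IsIdempotentElem.iff_eq_zero_or_one (p := hA.eigenvalues i)).mp h2 with h0 | h0 <;>
      simp [h0]
  have := hA.trace_eq_sum_eigenvalues
  simp only [Complex.coe_algebraMap] at this
  rw [this, traceNorm]
  push_cast
  exact Finset.sum_congr rfl fun i _ => by rw [key i]

/-- If the diamond norm of `Φ` is at most `ε`, then so is each matrix element
`⟨χ| Φ (|φ⟩⟨r|) |r⟩` for unit vectors `φ` and `χ` and a basis vector `r`. -/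
theorem norm_sum_star_mul_le_of_diamondNorm_le {Φ : Matrix ι ι ℂ → Matrix ι ι ℂ} {ε : ℝ}
    (hε : 0 ≤ ε) (hΦ : diamondNorm Φ ≤ ENNReal.ofReal ε) (φ χ : ι → ℂ) (r : ι)
    (hφ : ∑ a, ‖φ a‖ ^ 2 = 1) (hχ : ∑ a, ‖χ a‖ ^ 2 = 1) :
    ‖∑ a, star (χ a) * Φ (Matrix.vecMulVec φ (Pi.single r 1)) a r‖ ≤ ε := by
  set X : Matrix (ι × Fin 1) (ι × Fin 1) ℂ :=
    Matrix.of fun a b => Matrix.vecMulVec φ (Pi.single r 1) a.1 b.1 with hXdef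
  have hφ' : ∑ a, star (φ a) * φ a = 1 := by
    have : ((∑ a, ‖φ a‖ ^ 2 : ℝ) : ℂ) = 1 := by rw [hφ]; simp
    rw [← this]
    push_cast
    exact Finset.sum_congr rfl fun a _ => Complex.conj_mul' (φ a)
  have hXX : X.conjTranspose * X = Matrix.single (r, 0) (r, 0) 1 := by
    ext ⟨a, i⟩ ⟨b, j⟩
    fin_cases i
    fin_cases j
    simp only [Matrix.mul_apply, Matrix.conjTranspose_apply, hXdef, Matrix.of_apply,
      Matrix.vecMulVec_apply, Fintype.sum_prod_type, Finset.univ_unique, Finset.sum_singleton,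
      Matrix.single_apply, Prod.mk.injEq, star_mul']
    have : ∀ c, star (φ c) * star ((Pi.single r 1 : ι → ℂ) a) * (φ c * (Pi.single r 1 : ι → ℂ) b)
        = (star (φ c) * φ c) * (star ((Pi.single r 1 : ι → ℂ) a) * (Pi.single r 1 : ι → ℂ) b) :=
      fun c => by ring
    simp only [this, ← Finset.sum_mul, hφ', one_mul]
    by_cases ha : r = a <;> by_cases hb : r = b <;> simp [Pi.single_apply, ha, hb, eq_comm]
  have hX : traceNorm X ≤ 1 := by
    have h := traceNorm_eq_trace_of_isIdempotent X (by
      rw [hXX, IsIdempotentElem, Matrix.single_mul_single_same, one_mul])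
    rw [hXX, Matrix.trace_single_eq_same] at h
    exact le_of_eq (by exact_mod_cast h)
  have hle : traceNorm (tensorId 1 Φ X) ≤ ε := by
    rw [← ENNReal.ofReal_le_ofReal_iff hε]
    refine le_trans ?_ hΦ
    -- A one-dimensional reference system suffices, because the phase reference `r` lies in the
    -- system itself.
    exact le_iSup_of_le 1 (le_iSup_of_le X (le_iSup_of_le hX le_rfl))
  set Y := Φ (Matrix.vecMulVec φ (Pi.single r 1)) with hY
  have hF := sum_normSq_le_traceNorm_sq (tensorId 1 Φ X)
  have hY' : ∀ a b, tensorId 1 Φ X (a, 0) (b, 0) = Y a b := fun a b => rfl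
  simp only [Fintype.sum_prod_type, Finset.univ_unique, Finset.sum_singleton,
    Fin.default_eq_zero, hY'] at hF
  have h0 : 0 ≤ traceNorm (tensorId 1 Φ X) := Finset.sum_nonneg fun i _ => Real.sqrt_nonneg _
  refine le_trans ?_ hle
  refine abs_le_of_sq_le_sq' ?_ h0 |>.2
  refine le_trans ?_ hF
  calc ‖∑ a, star (χ a) * Y a r‖ ^ 2 ≤ (∑ a, ‖χ a‖ * ‖Y a r‖) ^ 2 := by
        gcongr
        refine (norm_sum_le _ _).trans (le_of_eq ?_)
        simp
    _ ≤ (∑ a, ‖χ a‖ ^ 2) * ∑ a, ‖Y a r‖ ^ 2 := Finset.sum_mul_sq_le_sq_mul_sq _ _ _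
    _ = ∑ a, ‖Y a r‖ ^ 2 := by rw [hχ, one_mul]
    _ ≤ ∑ a, ∑ b, ‖Y a b‖ ^ 2 := Finset.sum_le_sum fun a _ =>
        Finset.single_le_sum (f := fun b => ‖Y a b‖ ^ 2) (fun b _ => by positivity)
          (Finset.mem_univ r)

end

/-! ### Solving the Schrödinger equation -/

section

attribute [local instance] Matrix.linftyOpNormedRing Matrix.linftyOpNormedAlgebra

/-- For a solution `v` of the Schrödinger equation, `exp (i s H) v(s)` has derivative zero. So an
explicit solution determines the evolution without diagonalization. -/
theorem evolution_mulVec_of_hasDerivAt {ι : Type} [Fintype ι] [DecidableEq ι]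
    (H : Matrix ι ι ℂ) (v : ℝ → ι → ℂ)
    (hv : ∀ s i, HasDerivAt (fun s => v s i) (-Complex.I * (H.mulVec (v s)) i) s) (t : ℝ) :
    (evolution H t).mulVec (v 0) = v t := by
  set K : Matrix ι ι ℂ := Complex.I • H with hK
  have hE : ∀ s : ℝ, HasDerivAt (fun s : ℝ => NormedSpace.exp (s • K))
      (NormedSpace.exp (s • K) * K) s := fun s => hasDerivAt_exp_smul_const K s
  have hEij : ∀ (s : ℝ) i j, HasDerivAt (fun s : ℝ => NormedSpace.exp (s • K) i j)
      ((NormedSpace.exp (s • K) * K) i j) s := by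
    intro s i j
    let T : Matrix ι ι ℂ →L[ℝ] ℂ :=
      LinearMap.toContinuousLinearMap (Matrix.entryLinearMap ℝ ℂ i j)
    exact (T.hasFDerivAt.comp_hasDerivAt s (hE s))
  have hu : ∀ i (s : ℝ), HasDerivAt
      (fun s => ((NormedSpace.exp (s • K)).mulVec (v s)) i) 0 s := by
    intro i s
    have h1 := HasDerivAt.fun_sum (u := Finset.univ) fun j _ => (hEij s i j).mul (hv s j)
    have h2 : ∑ j, ((NormedSpace.exp (s • K) * K) i j * v s j
        + NormedSpace.exp (s • K) i j * (-Complex.I * (H.mulVec (v s)) j)) = 0 := by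
      rw [Finset.sum_add_distrib]
      have e1 : ∑ j, (NormedSpace.exp (s • K) * K) i j * v s j
          = ((NormedSpace.exp (s • K)).mulVec (K.mulVec (v s))) i := by
        rw [Matrix.mulVec_mulVec]; rfl
      have e2 : ∑ j, NormedSpace.exp (s • K) i j * (-Complex.I * (H.mulVec (v s)) j)
          = -((NormedSpace.exp (s • K)).mulVec (K.mulVec (v s))) i := by
        rw [hK, Matrix.smul_mulVec, Matrix.mulVec, dotProduct, ← Finset.sum_neg_distrib]
        refine Finset.sum_congr rfl fun j _ => ?_
        simp
      rw [e1, e2, add_neg_cancel]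
    rw [h2] at h1
    exact h1
  have hc : (NormedSpace.exp (t • K)).mulVec (v t) = v 0 := by
    ext i
    have := is_const_of_deriv_eq_zero (fun s => (hu i s).differentiableAt)
      (fun s => (hu i s).deriv) t 0
    rw [this]
    simp
  have he : evolution H t = NormedSpace.exp (-(t • K)) := by
    rw [evolution, hK]
    congr 1
    ext i j
    simp
    ring
  rw [← hc, he, Matrix.mulVec_mulVec, ← Matrix.exp_add_of_commute _ _ (Commute.refl (t • K)).neg_left]
  simp

end

/-! ### The signed path Hamiltonian -/

/-- The unsigned weight of the edge between the sites `k` and `k + 1` of a path with sites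
`0, …, N`. -/
noncomputable def edgeWeight (N k : ℕ) : ℝ := √((k + 1) * (N - k))

theorem edgeWeight_nonneg (N k : ℕ) : 0 ≤ edgeWeight N k := Real.sqrt_nonneg _

/-- AM-GM: the two factors under the root sum to `N + 1`. -/
theorem edgeWeight_le (N k : ℕ) : edgeWeight N k ≤ (N + 1) / 2 := by
  refine Real.sqrt_le_iff.mpr ⟨by positivity, ?_⟩
  nlinarith [sq_nonneg ((k + 1 : ℝ) - (N - k))]

/-- The matrix elements of the path on which the edge between `k` and `k + 1` carries the sign
`y k`. -/
noncomputable def hop (N : ℕ) (y : ℕ → ℝ) (k l : ℕ) : ℝ :=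
  (if l = k + 1 then edgeWeight N k * y k else 0) + if k = l + 1 then edgeWeight N l * y l else 0

theorem hop_comm (N : ℕ) (y : ℕ → ℝ) (k l : ℕ) : hop N y k l = hop N y l k := add_comm _ _

theorem abs_hop_le {N : ℕ} {y : ℕ → ℝ} (hy : ∀ k, |y k| = 1) (k l : ℕ) :
    |hop N y k l| ≤ (N + 1) / 2 := by
  have h : ∀ k, |edgeWeight N k * y k| ≤ ((N : ℝ) + 1) / 2 := fun k => by
    rw [abs_mul, hy, mul_one, abs_of_nonneg (edgeWeight_nonneg N k)]
    exact edgeWeight_le N k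
  have h0 : (0 : ℝ) ≤ ((N : ℝ) + 1) / 2 := by positivity
  rw [hop]
  split_ifs with h1 h2 h2
  · omega
  · simpa using h k
  · simpa using h l
  · simpa using h0

theorem eq_or_eq_of_hop_ne_zero {N : ℕ} {y : ℕ → ℝ} {k l : ℕ} (h : hop N y k l ≠ 0) :
    l = k + 1 ∨ k = l + 1 := by
  by_contra! hne
  simp [hop, hne.1, hne.2] at h

theorem hop_congr {N : ℕ} {y y' : ℕ → ℝ} {k : ℕ} (h1 : y k = y' k)
    (h2 : ∀ l, l + 1 = k → y l = y' l) (l : ℕ) : hop N y k l = hop N y' k l := by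
  rw [hop, hop, h1]
  congr 1
  split_ifs with hl
  · rw [h2 l hl.symm]
  · rfl

theorem sum_hop_mul (N : ℕ) (y : ℕ → ℝ) (F : ℕ → ℂ) {k : ℕ} (hk : k ≤ N) :
    ∑ l : Fin (N + 1), (hop N y k l : ℂ) * F l
      = (edgeWeight N k * y k : ℝ) * F (k + 1)
        + if k = 0 then 0 else ((edgeWeight N (k - 1) * y (k - 1) : ℝ) : ℂ) * F (k - 1) := by
  rw [Fin.sum_univ_eq_sum_range (fun l => (hop N y k l : ℂ) * F l)]
  simp only [hop, Complex.ofReal_add, add_mul, Finset.sum_add_distrib]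
  congr 1
  · rcases hk.eq_or_lt with rfl | hk
    · rw [Finset.sum_eq_zero]
      -- At `k = N` the site `k + 1` does not exist, but its weight vanishes.
      · simp [edgeWeight]
      · intro l hl
        rw [Finset.mem_range] at hl
        rw [if_neg (by omega)]
        simp
    · rw [Finset.sum_eq_single (k + 1)]
      · simp
      · intro l _ hl
        simp [hl]
      · intro h
        simp at h
        omega
  · rcases k with _ | k
    · simp
    · rw [Finset.sum_eq_single k]
      · simp
      · intro l _ hl
        rw [if_neg (by omega)]
        simp
      · intro h
        simp at h
        omega

/-- The amplitudes at time `2 θ` of a spin-`N / 2` that rotates about the `x` axis, starting from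
the extremal state. -/
noncomputable def spinAmplitude (N k : ℕ) (θ : ℝ) : ℂ :=
  (√(N.choose k) : ℝ) * ((Real.cos θ : ℂ) ^ (N - k) * (-Complex.I * (Real.sin θ : ℂ)) ^ k)

theorem edgeWeight_mul_sqrt_choose_succ {N k : ℕ} (hk : k ≤ N) :
    edgeWeight N k * √(N.choose (k + 1)) = √(N.choose k) * (N - k : ℕ) := by
  have h : ((k : ℝ) + 1) * (N - k) * N.choose (k + 1) = N.choose k * ((N - k : ℕ) : ℝ) ^ 2 := by
    have := N.choose_succ_right_eq k
    have h2 : (N.choose (k + 1) : ℝ) * (k + 1) = N.choose k * (N - k : ℕ) := by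
      exact_mod_cast this
    rw [Nat.cast_sub hk] at *
    linear_combination ((N : ℝ) - k) * h2
  rw [edgeWeight, ← Real.sqrt_mul (mul_nonneg (by positivity)
    (sub_nonneg.mpr (by exact_mod_cast hk))), h, Real.sqrt_mul (by positivity),
    Real.sqrt_sq (by positivity)]

theorem edgeWeight_mul_sqrt_choose {N k : ℕ} (hk : k < N) :
    edgeWeight N k * √(N.choose k) = √(N.choose (k + 1)) * (k + 1) := by
  have h : ((k : ℝ) + 1) * (N - k) * N.choose k = N.choose (k + 1) * ((k : ℝ) + 1) ^ 2 := by
    have := N.choose_succ_right_eq k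
    have h2 : (N.choose (k + 1) : ℝ) * (k + 1) = N.choose k * (N - k : ℕ) := by
      exact_mod_cast this
    rw [Nat.cast_sub hk.le] at *
    linear_combination -((k : ℝ) + 1) * h2
  rw [edgeWeight, ← Real.sqrt_mul (mul_nonneg (by positivity)
    (sub_nonneg.mpr (by exact_mod_cast hk.le))), h, Real.sqrt_mul (by positivity),
    Real.sqrt_sq (by positivity)]

/-- In the product rule, differentiating the cosine power yields the neighbour `k + 1` and
differentiating the sine power yields `k - 1`; the binomial identities above turn the coefficients
into edge weights. -/
theorem hasDerivAt_spinAmplitude {N k : ℕ} (hk : k ≤ N) (θ : ℝ) :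
    HasDerivAt (spinAmplitude N k) (-Complex.I * ((edgeWeight N k : ℝ) * spinAmplitude N (k + 1) θ
      + if k = 0 then 0 else (edgeWeight N (k - 1) : ℝ) * spinAmplitude N (k - 1) θ)) θ := by
  have hc : HasDerivAt (fun θ : ℝ => (Real.cos θ : ℂ)) (-(Real.sin θ : ℂ)) θ := by
    simpa using (Real.hasDerivAt_cos θ).ofReal_comp
  have hs : HasDerivAt (fun θ : ℝ => -Complex.I * (Real.sin θ : ℂ))
      (-Complex.I * (Real.cos θ : ℂ)) θ :=
    ((Real.hasDerivAt_sin θ).ofReal_comp).const_mul _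
  have h := (((hc.fun_pow (N - k)).mul (hs.fun_pow k)).const_mul ((√(N.choose k) : ℝ) : ℂ))
  refine h.congr_deriv ?_
  set C := (Real.cos θ : ℂ) with hC
  set S := (Real.sin θ : ℂ) with hS
  have e1 : ((edgeWeight N k : ℝ) : ℂ) * spinAmplitude N (k + 1) θ
      = (√(N.choose k) : ℝ) * ((N - k : ℕ) * (C ^ (N - k - 1) * (-Complex.I * S) ^ (k + 1))) := by
    have := congrArg (fun r : ℝ => (r : ℂ)) (edgeWeight_mul_sqrt_choose_succ hk)
    push_cast at this
    rw [spinAmplitude, ← mul_assoc, this, Nat.sub_sub]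
    ring
  rw [e1]
  have e3 : -S = -Complex.I * (-Complex.I * S) := by
    linear_combination (-S) * Complex.I_sq
  rcases k with _ | k
  · rw [e3]
    simp
    ring
  · have e2 : ((edgeWeight N k : ℝ) : ℂ) * spinAmplitude N k θ
        = (√(N.choose (k + 1)) : ℝ) * ((k + 1) * (C ^ (N - (k + 1) + 1) * (-Complex.I * S) ^ k)) := by
      have := congrArg (fun r : ℝ => (r : ℂ)) (edgeWeight_mul_sqrt_choose (N := N) (k := k) hk)
      push_cast at this
      rw [spinAmplitude, ← mul_assoc, this, show N - k = N - (k + 1) + 1 by omega]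
      ring
    rw [if_neg (by omega), Nat.add_sub_cancel, e2, e3]
    push_cast
    ring

theorem spinAmplitude_zero (N k : ℕ) : spinAmplitude N k 0 = if k = 0 then 1 else 0 := by
  rcases k with _ | k <;> simp [spinAmplitude]

theorem spinAmplitude_self (N : ℕ) (θ : ℝ) :
    spinAmplitude N N θ = (-Complex.I * (Real.sin θ : ℂ)) ^ N := by
  simp [spinAmplitude]

/-- The signed path with matrix elements scaled by `g` and every site replaced by `D` copies,
together with `m + 2` isolated vertices, the first of which has the energy `h`. -/
noncomputable def pathHamiltonian (N D m : ℕ) (g h : ℝ) (y : ℕ → ℝ) :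
    Matrix ((Fin (N + 1) × Fin D) ⊕ Fin (m + 2)) ((Fin (N + 1) × Fin D) ⊕ Fin (m + 2)) ℂ :=
  Matrix.fromBlocks (Matrix.of fun p q => ((g * hop N y p.1 q.1 : ℝ) : ℂ)) 0 0
    (Matrix.single 0 0 (h : ℂ))

theorem isHermitian_pathHamiltonian (N D m : ℕ) (g h : ℝ) (y : ℕ → ℝ) :
    (pathHamiltonian N D m g h y).IsHermitian := by
  refine Matrix.IsHermitian.fromBlocks ?_ (by simp) ?_
  · ext p q
    simp [hop_comm N y p.1 q.1]
  · exact (Matrix.conjTranspose_single _ _ _).trans (by simp)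

theorem norm_pathHamiltonian_le {N D m : ℕ} {g h : ℝ} {y : ℕ → ℝ} (hy : ∀ k, |y k| = 1)
    (hg : |g| * ((N + 1) / 2) ≤ h) (p q) : ‖pathHamiltonian N D m g h y p q‖ ≤ h := by
  have h0 : 0 ≤ h := le_trans (by positivity) hg
  rcases p with p | p <;> rcases q with q | q
  · simp only [pathHamiltonian, Matrix.fromBlocks_apply₁₁, Matrix.of_apply, Complex.norm_real,
      Real.norm_eq_abs, abs_mul]
    exact (mul_le_mul_of_nonneg_left (abs_hop_le hy _ _) (abs_nonneg g)).trans hg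
  · simpa [pathHamiltonian] using h0
  · simpa [pathHamiltonian] using h0
  · simp only [pathHamiltonian, Matrix.fromBlocks_apply₂₂, Matrix.single_apply]
    split_ifs
    · simp [abs_of_nonneg h0]
    · simpa using h0

theorem isSparse_pathHamiltonian {N D m d : ℕ} (hD : 2 * D ≤ d) (hd : 1 ≤ d) (g h : ℝ)
    (y : ℕ → ℝ) : IsSparse d (pathHamiltonian N D m g h y) := by
  rintro (⟨k, u⟩ | i)
  · set T : Finset (Fin (N + 1)) :=
      Finset.univ.filter fun l => (l : ℕ) = k + 1 ∨ (k : ℕ) = l + 1 with hT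
    have hTc : T.card ≤ 2 := by
      have h1 : T.image Fin.val ⊆ {(k : ℕ) + 1, (k : ℕ) - 1} := by
        intro a ha
        simp [hT] at ha ⊢
        obtain ⟨b, hb, rfl⟩ := ha
        omega
      rw [← Finset.card_image_of_injective T Fin.val_injective]
      exact (Finset.card_le_card h1).trans Finset.card_le_two
    have hsub : {q | pathHamiltonian N D m g h y (Sum.inl (k, u)) q ≠ 0}
        ⊆ ((T ×ˢ (Finset.univ : Finset (Fin D))).image Sum.inl :
          Finset ((Fin (N + 1) × Fin D) ⊕ Fin (m + 2))) := by
      rintro (⟨l, v⟩ | j) hq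
      · simp only [pathHamiltonian, Set.mem_ofPred_eq, Matrix.fromBlocks_apply₁₁, Matrix.of_apply,
          ne_eq, Complex.ofReal_eq_zero, mul_eq_zero, not_or] at hq
        simpa [hT] using eq_or_eq_of_hop_ne_zero hq.2
      · simp [pathHamiltonian] at hq
    refine (Set.ncard_le_ncard hsub (Finset.finite_toSet _)).trans ?_
    rw [Set.ncard_coe_finset]
    refine Finset.card_image_le.trans ?_
    rw [Finset.card_product, Finset.card_univ, Fintype.card_fin]
    exact (Nat.mul_le_mul_right D hTc).trans hD
  · have hsub : {q | pathHamiltonian N D m g h y (Sum.inr i) q ≠ 0} ⊆ {Sum.inr 0} := by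
      rintro (q | j) hq
      · simp [pathHamiltonian] at hq
      · simp only [pathHamiltonian, Set.mem_ofPred_eq, Matrix.fromBlocks_apply₂₂,
          Matrix.single_apply] at hq
        simp only [Set.mem_singleton_iff, Sum.inr.injEq]
        by_contra hj
        simp [Ne.symm hj] at hq
    exact (Set.ncard_le_ncard hsub (Set.finite_singleton _)).trans (by simpa using hd)

/-- The state that spreads the amplitude of each site evenly over its `D` copies. -/
noncomputable def pathState (N D m : ℕ) (y : ℕ → ℝ) (θ : ℝ) :
    (Fin (N + 1) × Fin D) ⊕ Fin (m + 2) → ℂ :=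
  Sum.elim (fun p => ((√D)⁻¹ * ∏ j ∈ Finset.range p.1, y j : ℝ) * spinAmplitude N p.1 θ)
    fun _ => 0

/-- The partial products of the signs are the gauge that reduces the signed path to the unsigned
one, by `y k ^ 2 = 1`. The `D` equal contributions from the copies of a neighbour cancel the `D` in
`ω / D`. -/
theorem hasDerivAt_pathState {N D m : ℕ} {y : ℕ → ℝ} (hD : D ≠ 0) (hy : ∀ k, |y k| = 1)
    (ω h : ℝ) (s : ℝ) (p) :
    HasDerivAt (fun s => pathState N D m y (ω * s) p)
      (-Complex.I * ((pathHamiltonian N D m (ω / D) h y).mulVec (pathState N D m y (ω * s))) p)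
      s := by
  rcases p with ⟨k, u⟩ | i
  · have hk : (k : ℕ) ≤ N := by omega
    have h1 := ((hasDerivAt_spinAmplitude hk (ω * s)).scomp s
      ((hasDerivAt_id s).const_mul ω)).const_mul
        (((√D)⁻¹ * ∏ j ∈ Finset.range k, y j : ℝ) : ℂ)
    refine h1.congr_deriv ?_
    have hsq : y k * y k = 1 := by rw [← abs_mul_abs_self, hy]; norm_num
    have hsum : ((pathHamiltonian N D m (ω / D) h y).mulVec (pathState N D m y (ω * s)))
        (Sum.inl (k, u)) = ∑ l : Fin (N + 1), (hop N y k l : ℂ) * (ω * ((√D)⁻¹ : ℝ) *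
          ((∏ j ∈ Finset.range l, y j : ℝ) * spinAmplitude N l (ω * s))) := by
      simp only [Matrix.mulVec, dotProduct, Fintype.sum_sum_type, pathHamiltonian,
        Matrix.fromBlocks_apply₁₁, Matrix.fromBlocks_apply₁₂, pathState, Sum.elim_inl,
        Sum.elim_inr, mul_zero, Finset.sum_const_zero, add_zero, Fintype.sum_prod_type,
        Matrix.of_apply, Finset.sum_const, Finset.card_univ, Fintype.card_fin, nsmul_eq_mul]
      refine Finset.sum_congr rfl fun l _ => ?_
      have : (D : ℂ) ≠ 0 := by exact_mod_cast hD
      push_cast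
      field_simp
    rw [hsum, sum_hop_mul N y (fun l => ω * ((√D)⁻¹ : ℝ) *
          ((∏ j ∈ Finset.range l, y j : ℝ) * spinAmplitude N l (ω * s))) hk]
    have hsq' : (y k : ℂ) * y k = 1 := by exact_mod_cast hsq
    obtain ⟨k, hk'⟩ := k
    rcases k with _ | k
    · simp only [Finset.prod_range_succ, Finset.prod_range_zero] at hsq' ⊢
      simp only [if_true]
      push_cast
      simp only [Complex.real_smul]
      push_cast
      linear_combination (-1 : ℂ) * (-Complex.I * edgeWeight N 0 * ω * (√D : ℂ)⁻¹ *
        spinAmplitude N (0 + 1) (ω * s)) * hsq'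
    · simp only [Finset.prod_range_succ, Nat.add_sub_cancel, Nat.succ_ne_zero, if_false] at hsq' ⊢
      simp only [Complex.real_smul]
      push_cast
      linear_combination (-1 : ℂ) * (-Complex.I * edgeWeight N (k + 1) * ω * (√D : ℂ)⁻¹ *
        spinAmplitude N (k + 1 + 1) (ω * s) * (∏ j ∈ Finset.range k, (y j : ℂ)) * y k) * hsq'
  · have : ((pathHamiltonian N D m (ω / D) h y).mulVec (pathState N D m y (ω * s)))
        (Sum.inr i) = 0 := by
      simp [Matrix.mulVec, dotProduct, pathHamiltonian, pathState]
    rw [this, mul_zero]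
    exact hasDerivAt_const s (0 : ℂ)

theorem sum_norm_pathState_zero_sq {N D m : ℕ} (y : ℕ → ℝ) (hD : D ≠ 0) :
    ∑ p, ‖pathState N D m y 0 p‖ ^ 2 = 1 := by
  simp only [Fintype.sum_sum_type, pathState, Sum.elim_inl, Sum.elim_inr, norm_zero,
    Fintype.sum_prod_type, spinAmplitude_zero, Finset.sum_const, Finset.card_univ,
    Fintype.card_fin, nsmul_eq_mul]
  rw [Finset.sum_eq_single 0]
  · have : (0 : ℝ) ≤ D := by positivity
    simp [hD, Real.sq_sqrt this]
  · intro k _ hk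
    have : (k : ℕ) ≠ 0 := fun h => hk (Fin.ext h)
    simp [this]
  · simp

/-- The state that is spread evenly over the copies of the last site. -/
noncomputable def lastState (N D m : ℕ) : (Fin (N + 1) × Fin D) ⊕ Fin (m + 2) → ℂ :=
  Sum.elim (fun p => if p.1 = Fin.last N then ((√D)⁻¹ : ℝ) else 0) fun _ => 0

theorem sum_norm_lastState_sq {N D m : ℕ} (hD : D ≠ 0) :
    ∑ p, ‖lastState N D m p‖ ^ 2 = 1 := by
  simp only [Fintype.sum_sum_type, lastState, Sum.elim_inl, Sum.elim_inr, norm_zero,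
    Fintype.sum_prod_type, Finset.sum_const, Finset.card_univ,
    Fintype.card_fin, nsmul_eq_mul]
  rw [Finset.sum_eq_single (Fin.last N)]
  · have : (0 : ℝ) ≤ D := by positivity
    simp [hD, Real.sq_sqrt this]
  · intro k _ hk
    simp [hk]
  · simp

theorem sum_star_lastState_mul {N D m : ℕ} (y : ℕ → ℝ) (hD : D ≠ 0) (θ : ℝ) :
    ∑ p, star (lastState N D m p) * pathState N D m y θ p
      = (∏ j ∈ Finset.range N, y j : ℝ) * (-Complex.I * (Real.sin θ : ℂ)) ^ N := by
  simp only [Fintype.sum_sum_type, lastState, pathState, Sum.elim_inl, Sum.elim_inr,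
    Fintype.sum_prod_type, Finset.sum_const, Finset.card_univ,
    Fintype.card_fin, nsmul_eq_mul]
  rw [Finset.sum_eq_single (Fin.last N)]
  · have h : (D : ℂ) * ((((√D)⁻¹ : ℝ) : ℂ) * (((√D)⁻¹ : ℝ) : ℂ)) = 1 := by
      have h0 : (0 : ℝ) ≤ D := by positivity
      have : (D : ℝ) * ((√D)⁻¹ * (√D)⁻¹) = 1 := by
        rw [← mul_inv, Real.mul_self_sqrt h0, mul_inv_cancel₀ (by exact_mod_cast hD)]
      exact_mod_cast this
    simp only [if_true, Fin.val_last, spinAmplitude_self, mul_zero, add_zero, Complex.star_def,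
      Complex.conj_ofReal, Finset.sum_const, Finset.card_univ, Fintype.card_fin, nsmul_eq_mul]
    rw [Complex.ofReal_mul]
    linear_combination ((∏ j ∈ Finset.range N, y j : ℝ) : ℂ)
      * (-Complex.I * (Real.sin θ : ℂ)) ^ N * h
  · intro k _ hk
    simp [hk]
  · simp

/-- The edge signs given by a bit string. -/
noncomputable def edgeSign {N : ℕ} (x : Fin N → Bool) (k : ℕ) : ℝ :=
  if h : k < N then bitSign (x ⟨k, h⟩) else 1

theorem abs_edgeSign {N : ℕ} (x : Fin N → Bool) (k : ℕ) : |edgeSign x k| = 1 := by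
  unfold edgeSign
  split_ifs
  · exact abs_bitSign _
  · simp

theorem prod_edgeSign {N : ℕ} (x : Fin N → Bool) :
    ∏ j ∈ Finset.range N, edgeSign x j = paritySign x := by
  rw [← Fin.prod_univ_eq_prod_range, paritySign]
  exact Finset.prod_congr rfl fun i _ => by simp [edgeSign]

/-- A row at site `k` sees only the edges `k - 1` and `k`. -/
theorem exists_dependsOn_pathHamiltonian (N D m : ℕ) (g h : ℝ) (p) :
    ∃ S : Finset (Fin N), S.card ≤ 2 ∧
      DependsOn (fun x : Fin N → Bool => pathHamiltonian N D m g h (edgeSign x) p) S := by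
  rcases p with ⟨k, u⟩ | i
  · refine ⟨Finset.univ.filter fun i => (i : ℕ) = k ∨ (i : ℕ) + 1 = k, ?_, ?_⟩
    · rw [← Finset.card_image_of_injective _ Fin.val_injective]
      refine (Finset.card_le_card (t := {(k : ℕ), (k : ℕ) - 1}) ?_).trans Finset.card_le_two
      intro a ha
      simp at ha ⊢
      obtain ⟨b, hb, rfl⟩ := ha
      omega
    · intro x x' hx
      have hl : ∀ l : ℕ, l = k ∨ l + 1 = k → edgeSign x l = edgeSign x' l := by
        intro l hl
        unfold edgeSign
        split_ifs with hN
        · rw [hx ⟨l, hN⟩ (by simpa using hl)]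
        · rfl
      ext (⟨l, v⟩ | j)
      · simp only [pathHamiltonian, Matrix.fromBlocks_apply₁₁, Matrix.of_apply]
        rw [hop_congr (hl k (Or.inl rfl)) fun l h => hl l (Or.inr h)]
      · simp [pathHamiltonian]
  · refine ⟨∅, by simp, fun x x' _ => ?_⟩
    ext (q | j) <;> simp [pathHamiltonian]

/-! ### Reduction from parity -/

/-- The reference turns an amplitude of `V φ` into a matrix entry of the output; a measured
probability would lose the sign that carries the parity. -/
theorem conjBy_vecMulVec_single_apply {ι : Type} [Fintype ι] [DecidableEq ι] (V : Matrix ι ι ℂ)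
    (φ : ι → ℂ) (r a : ι) (hr : V r r = 1) :
    conjBy V (Matrix.vecMulVec φ (Pi.single r 1)) a r = (V.mulVec φ) a := by
  rw [conjBy, Matrix.mul_vecMulVec, Matrix.vecMulVec_mul, Matrix.vecMulVec_apply,
    Matrix.single_one_vecMul, Matrix.row_apply, Matrix.conjTranspose_apply, hr, star_one, mul_one]

theorem evolution_apply_self_of_col_eq_zero {ι : Type} [Fintype ι] [DecidableEq ι]
    (H : Matrix ι ι ℂ) (t : ℝ) (r : ι) (hr : ∀ i, H i r = 0) : evolution H t r r = 1 := by
  have h := evolution_mulVec_of_hasDerivAt H (fun _ => Pi.single r 1) (fun s i => by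
    have : H.mulVec (Pi.single r 1) i = 0 := by simp [hr]
    rw [this, mul_zero]
    exact hasDerivAt_const s _) t
  simpa using congrFun h r

theorem maxNorm_eq {ι : Type} [Fintype ι] {H : Matrix ι ι ℂ} {h : ℝ} (hle : ∀ i j, ‖H i j‖ ≤ h)
    (i j : ι) (hij : ‖H i j‖ = h) : maxNorm H = h := by
  have : Nonempty ι := ⟨i⟩
  refine le_antisymm (ciSup_le fun p => hle p.1 p.2) ?_
  rw [← hij]
  exact le_ciSup (f := fun p : ι × ι => ‖H p.1 p.2‖) (Set.finite_range _).bddAbove (i, j)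

theorem isSparse_submatrix {ι κ : Type} [Fintype ι] [Fintype κ] {d : ℕ} {H : Matrix κ κ ℂ}
    (hH : IsSparse d H) (e : ι ≃ κ) : IsSparse d (H.submatrix e e) := by
  intro j
  have : {k | H.submatrix e e j k ≠ 0} = e ⁻¹' {k | H (e j) k ≠ 0} := rfl
  rw [this, Set.ncard_preimage_of_injective_subset_range e.injective (by simp)]
  exact hH (e j)

/-- If the path with `N` edges can be traversed with amplitude greater than `ε`, then simulation
requires `N / 4` queries, since parity is orthogonal to the functions of degree less than `N`. -/
theorem requiresQueries_of_lt_sin_pow {d N : ℕ} {h t ε θ : ℝ} (hd : 2 ≤ d) (ht : 0 < t)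
    (hε : 0 ≤ ε) (hθ : 0 ≤ θ) (hθN : θ * (N + 1) ≤ 2 * (d / 2 : ℕ) * h * t)
    (hsin : ε < |Real.sin θ| ^ N) : RequiresQueries d h t ε (N / 4) := by
  set D := d / 2 with hDdef
  have hD : D ≠ 0 := by omega
  have hDpos : (0 : ℝ) < D := by exact_mod_cast Nat.pos_of_ne_zero hD
  -- Crude but sufficient: `2 ^ n` exceeds `d` and leaves room for the path and two isolated
  -- vertices; `m` more pad the dimension.
  set n := (N + 1) * D + 2 + d with hn
  have hlt : n < 2 ^ n := Nat.lt_two_pow_self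
  obtain ⟨m, hm⟩ : ∃ m, 2 ^ n = (N + 1) * D + (m + 2) :=
    ⟨2 ^ n - (N + 1) * D - 2, by omega⟩
  have hcard : Fintype.card ((Fin (N + 1) × Fin D) ⊕ Fin (m + 2)) = 2 ^ n := by simp [hm]
  set e : Fin (2 ^ n) ≃ (Fin (N + 1) × Fin D) ⊕ Fin (m + 2) :=
    (Fintype.equivFinOfCardEq hcard).symm with he
  set ω := θ / t with hω
  have hωt : ω * t = θ := by rw [hω]; field_simp
  -- The hypothesis `hθN` is exactly the condition that the scaled path entries stay within `h`.
  have hg : |ω / D| * ((N + 1) / 2) ≤ h := by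
    rw [abs_of_nonneg (by positivity), hω, div_div, div_mul_div_comm, div_le_iff₀ (by positivity)]
    linarith
  set H : (Fin N → Bool) → Matrix (Fin (2 ^ n)) (Fin (2 ^ n)) ℂ := fun x =>
    (pathHamiltonian N D m (ω / D) h (edgeSign x)).submatrix e e with hH
  have h0 : 0 ≤ h := le_trans (by positivity) hg
  refine ⟨n, by omega, Set.range H, Set.finite_range H, ?_, ?_⟩
  · rintro _ ⟨x, rfl⟩
    refine ⟨(isHermitian_pathHamiltonian ..).submatrix e,
      isSparse_submatrix (isSparse_pathHamiltonian (by omega) (by omega) _ _ _) e, ?_⟩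
    refine maxNorm_eq (fun i j => norm_pathHamiltonian_le (abs_edgeSign x) hg _ _)
      (e.symm (Sum.inr 0)) (e.symm (Sum.inr 0)) ?_
    simp [hH, pathHamiltonian, abs_of_nonneg h0]
  intro b enc f A hA
  by_contra! hsim
  have hq : 2 * 2 * A.queries < N := by
    have : (4 : ℝ) * A.queries < N := by linarith
    have : 4 * A.queries < N := by exact_mod_cast this
    omega
  set r : Fin (2 ^ n) := e.symm (Sum.inr 1) with hr
  set φ : Fin (2 ^ n) → ℂ := fun a => pathState N D m (fun _ => 1) 0 (e a) with hφ
  set χ : Fin (2 ^ n) → ℂ := fun a => lastState N D m (e a) with hχ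
  set X := Matrix.vecMulVec φ (Pi.single r 1) with hX
  set κ := (-Complex.I * (Real.sin θ : ℂ)) ^ N with hκ
  have hstart : ∀ y, pathState N D m y 0 = pathState N D m (fun _ => 1) 0 := by
    intro y
    ext (⟨k, u⟩ | i)
    · by_cases hk : k = 0 <;> simp [pathState, spinAmplitude_zero, hk]
    · rfl
  set P : (Fin N → Bool) → ℂ := fun x => ∑ a, star (χ a) * A.channel enc f (H x) X a r with hP
  have hPdeg : P ∈ lowDegree N (2 * 2 * A.queries) := by
    refine sum_mem_lowDegree _ fun a => ?_
    have := mul_mem_lowDegree (const_mem_lowDegree (D := 0) (star (χ a)))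
      (channel_mem_lowDegree (r := 2) enc f A (H := H) (fun j => ?_) X a r)
    · rwa [zero_add] at this
    · obtain ⟨S, hS, h⟩ := exists_dependsOn_pathHamiltonian N D m (ω / D) h (e j)
      refine ⟨S, hS, fun x x' hx => ?_⟩
      ext k
      exact congrFun (h hx) (e k)
  have hideal : ∀ x, ∑ a, star (χ a) * conjBy (evolution (H x) t) X a r = paritySign x * κ := by
    intro x
    have hrr : evolution (H x) t r r = 1 := by
      refine evolution_apply_self_of_col_eq_zero _ _ _ fun i => ?_
      simp only [hH, Matrix.submatrix_apply, hr, Equiv.apply_symm_apply]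
      rcases e i with p | j <;> simp [pathHamiltonian]
    have hev := evolution_mulVec_of_hasDerivAt (H x)
      (fun s a => pathState N D m (edgeSign x) (ω * s) (e a)) (fun s a => by
        have := hasDerivAt_pathState (m := m) hD (abs_edgeSign x) ω h s (e a)
        convert this using 2
        simp only [hH, Matrix.submatrix_mulVec_equiv, Function.comp_def]
        simp) t
    simp only [mul_zero, hstart, hωt] at hev
    simp only [hX, conjBy_vecMulVec_single_apply _ φ r _ hrr]
    rw [hφ, hev, hχ, e.sum_comp (fun p => star (lastState N D m p)
      * pathState N D m (edgeSign x) θ p), sum_star_lastState_mul _ hD, prod_edgeSign]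
  have hclose : ∀ x, ‖P x - paritySign x * κ‖ ≤ ε := by
    intro x
    have := norm_sum_star_mul_le_of_diamondNorm_le hε (hsim (H x) ⟨x, rfl⟩) φ χ r
      (by rw [hφ, e.sum_comp (fun p => ‖pathState N D m (fun _ => 1) 0 p‖ ^ 2),
        sum_norm_pathState_zero_sq _ hD])
      (by rw [hχ, e.sum_comp (fun p => ‖lastState N D m p‖ ^ 2), sum_norm_lastState_sq hD])
    rw [← hideal x, hP]
    simpa only [← Finset.sum_sub_distrib, ← mul_sub, Matrix.sub_apply] using this
  have hκn : ‖κ‖ = |Real.sin θ| ^ N := by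
    rw [hκ, norm_pow, norm_mul, norm_neg, Complex.norm_I, one_mul, Complex.norm_real,
      Real.norm_eq_abs]
  have hzero := sum_paritySign_mul_eq_zero hq hPdeg
  have hsgn : ∀ x : Fin N → Bool, ((paritySign x : ℝ) : ℂ) * paritySign x = 1 := fun x => by
    have : paritySign x * paritySign x = 1 := by
      rw [← abs_mul_abs_self, abs_paritySign, one_mul]
    exact_mod_cast this
  -- `P` drops out by orthogonality, while the `2 ^ N` ideal terms add up coherently.
  have hsum : ∑ x : Fin N → Bool, (paritySign x : ℂ) * (P x - paritySign x * κ)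
      = -((2 : ℂ) ^ N * κ) := by
    simp only [mul_sub, Finset.sum_sub_distrib, hzero, ← mul_assoc, hsgn]
    simp
  have hle : ‖∑ x : Fin N → Bool, (paritySign x : ℂ) * (P x - paritySign x * κ)‖
      ≤ 2 ^ N * ε := by
    refine (norm_sum_le_of_le (f := fun x => (paritySign x : ℂ) * (P x - paritySign x * κ))
      (n := fun _ => ε) _ fun x _ => ?_).trans (by simp)
    rw [norm_mul, Complex.norm_real, Real.norm_eq_abs, abs_paritySign, one_mul]
    exact hclose x
  rw [hsum, norm_neg, norm_mul, norm_pow, Complex.norm_ofNat, hκn] at hle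
  exact absurd (le_of_mul_le_mul_left hle (by positivity)) (not_le.mpr hsin)

/-! ### Choice of the parameters -/

theorem RequiresQueries.mono {d : ℕ} {h t ε B B' : ℝ} (hB : RequiresQueries d h t ε B)
    (hle : B' ≤ B) : RequiresQueries d h t ε B' := by
  obtain ⟨n, hn, F, hF, hF', hfail⟩ := hB
  exact ⟨n, hn, F, hF, hF', fun b enc f A hA => hfail b enc f A (hA.trans_le hle)⟩

theorem le_three_mul_half {d : ℕ} (hd : 2 ≤ d) : (d : ℝ) ≤ 3 * (d / 2 : ℕ) := by
  have : d ≤ 3 * (d / 2) := by omega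
  exact_mod_cast this

/-- No fast-forwarding. -/
theorem requiresQueries_time {d : ℕ} {h t ε : ℝ} (hd : 2 ≤ d) (hh : 0 < h) (ht : 0 < t)
    (hε : 0 < ε) (hε1 : ε < 1) (hτ : 64 ≤ d * h * t) :
    RequiresQueries d h t ε (1 / 64 * (d * h * t)) := by
  set τ := d * h * t with hτdef
  have hN1 : (⌊τ / 4⌋₊ : ℝ) ≤ τ / 4 := Nat.floor_le (by linarith)
  have hN2 : τ / 4 < ⌊τ / 4⌋₊ + 1 := Nat.lt_floor_add_one _
  -- At θ = π/2 the transfer is perfect, so every ε < 1 is covered. The norm budget is at least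
  -- 2τ/3, and (π/2)(τ/4 + 1) fits for τ ≥ 64.
  refine (requiresQueries_of_lt_sin_pow (N := ⌊τ / 4⌋₊) (θ := Real.pi / 2) hd ht hε.le
    (by positivity) ?_ (by simpa using hε1)).mono (by linarith)
  have h1 : τ ≤ 3 * (d / 2 : ℕ) * (h * t) := by
    rw [hτdef, mul_assoc]
    exact mul_le_mul_of_nonneg_right (le_three_mul_half hd) (by positivity)
  have h2 : Real.pi / 2 * (⌊τ / 4⌋₊ + 1) ≤ 3.15 / 2 * (τ / 4 + 1) := by
    gcongr
    exact Real.pi_lt_d2.le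
  linarith

/-- A short evolution reaches the end of the path with amplitude larger than `ε`. -/
theorem requiresQueries_precision {d : ℕ} {h t ε s : ℝ} (hd : 2 ≤ d) (hh : 0 < h) (ht : 0 < t)
    (hs : 0 < s) (hs1 : s ≤ 1) (hsτ : 2 * s ≤ d * h * t) (hε : 0 < ε)
    (hlog : 2 / s ≤ Real.log (Real.log (1 / ε)))
    (hR : 64 ≤ Real.log (1 / ε) / Real.log (Real.log (1 / ε))) :
    RequiresQueries d h t ε (1 / 64 * (Real.log (1 / ε) / Real.log (Real.log (1 / ε)))) := by
  set L := Real.log (1 / ε) with hL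
  set R := L / Real.log L with hRdef
  have hlogpos : 0 < Real.log L := lt_of_lt_of_le (by positivity) hlog
  have hLR : L = R * Real.log L := by rw [hRdef]; field_simp
  have hLpos : 0 < L := by rw [hLR]; positivity
  set N := ⌊R / 2⌋₊ with hN
  have hN1 : (N : ℝ) ≤ R / 2 := Nat.floor_le (by linarith)
  have hN2 : R / 2 < N + 1 := Nat.lt_floor_add_one _
  -- Now θ(N+1) = s ≤ τ/2 respects the norm budget however long the path is.
  set θ := s / (N + 1) with hθ
  have hNpos : (0 : ℝ) < N + 1 := by positivity
  have hθpos : 0 < θ := by positivity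
  have hθ1 : θ ≤ 1 := by
    rw [hθ, div_le_one hNpos]
    linarith [(Nat.cast_nonneg N : (0 : ℝ) ≤ N)]
  refine (requiresQueries_of_lt_sin_pow (N := N) (θ := θ) hd ht hε.le hθpos.le ?_ ?_).mono
    (by linarith)
  · rw [hθ, div_mul_cancel₀ _ hNpos.ne']
    have h1 : d * h * t ≤ 3 * (d / 2 : ℕ) * (h * t) := by
      rw [mul_assoc]
      exact mul_le_mul_of_nonneg_right (le_three_mul_half hd) (by positivity)
    have h2 : 0 ≤ (d / 2 : ℕ) * (h * t) := by positivity
    linarith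
  -- As `N + 1 ≤ R`, `hlog` gives Lθ ≥ 2, and Jordan's inequality loses at most a factor 2. Then
  -- |sin θ|^N ≥ L^(-N) > L^(-R) = ε.
  · have hsin : L⁻¹ ≤ |Real.sin θ| := by
      have h1 : 2 / Real.pi * θ ≤ Real.sin θ :=
        Real.mul_le_sin hθpos.le (by linarith [Real.pi_gt_three])
      have h2 : L⁻¹ ≤ 2 / Real.pi * θ := by
        rw [inv_le_iff_one_le_mul₀ hLpos, hLR]
        have h3 : 2 ≤ s * Real.log L := by
          rw [div_le_iff₀ hs] at hlog
          linarith
        have h4 : N + 1 ≤ R := by linarith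
        have h5 : 1 ≤ R / (N + 1) := (one_le_div hNpos).mpr h4
        have h6 : 1 / 2 ≤ 2 / Real.pi := by
          rw [div_le_div_iff₀ two_pos Real.pi_pos]
          linarith [Real.pi_le_four]
        calc (1 : ℝ) = 1 / 2 * (1 * 2) := by norm_num
          _ ≤ 2 / Real.pi * (R / (N + 1) * (s * Real.log L)) := by gcongr
          _ = 2 / Real.pi * θ * (R * Real.log L) := by rw [hθ]; ring
      exact (h2.trans h1).trans (le_abs_self _)
    refine lt_of_lt_of_le ?_ (pow_le_pow_left₀ (by positivity) hsin N)
    have hε' : ε = Real.exp (-L) := by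
      rw [hL, one_div, Real.log_inv, neg_neg, Real.exp_log hε]
    have hLN : L⁻¹ ^ N = Real.exp (-(N * Real.log L)) := by
      rw [Real.exp_neg, mul_comm, Real.exp_mul, Real.exp_log hLpos, Real.rpow_natCast, inv_pow]
    rw [hLN, hε', Real.exp_lt_exp, neg_lt_neg_iff]
    have hNR : (N : ℝ) < R := by linarith
    calc N * Real.log L < R * Real.log L := mul_lt_mul_of_pos_right hNR hlogpos
      _ = L := hLR.symm

open Filter in
theorem tendsto_div_log_atTop : Tendsto (fun x : ℝ => x / Real.log x) atTop atTop := by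
  have h : Tendsto (fun x : ℝ => Real.log x / x) atTop (nhdsWithin 0 (Set.Ioi 0)) := by
    refine tendsto_nhdsWithin_iff.mpr ⟨Real.isLittleO_log_id_atTop.tendsto_div_nhds_zero, ?_⟩
    filter_upwards [eventually_gt_atTop 1] with x hx
    exact div_pos (Real.log_pos hx) (by linarith)
  exact h.inv_tendsto_nhdsGT_zero.congr fun x => by simp

end HamSim

theorem theorem2 :
    ∃ c : ℝ, 0 < c ∧
      (∀ τ₀ : ℝ, 0 < τ₀ → ∃ ε₀ : ℝ, 0 < ε₀ ∧ ε₀ < Real.exp (-1) ∧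
        ∀ (d : ℕ) (h t ε : ℝ), 2 ≤ d → 0 < h → 0 < t → 0 < ε → ε ≤ ε₀ →
          τ₀ ≤ d * h * t →
          HamSim.RequiresQueries d h t ε
            (c * (d * h * t + Real.log (1 / ε) / Real.log (Real.log (1 / ε))))) ∧
      (∀ (d : ℕ) (h t ε : ℝ), 2 ≤ d → 0 < h → 0 < t → 0 < ε → ε < 1 →
        1 ≤ c * (d * h * t) →
        HamSim.RequiresQueries d h t ε (c * (d * h * t))) := by
  -- Half of `1 / 64`, since the sum of the two terms is at most twice the larger.
  refine ⟨1 / 128, by norm_num, fun τ₀ hτ₀ => ?_, fun d h t ε hd hh ht hε hε1 hτ =>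
    (HamSim.requiresQueries_time hd hh ht hε hε1 (by linarith)).mono (by linarith)⟩
  set s := min τ₀ 1 / 2 with hs
  have hspos : 0 < s := half_pos (lt_min hτ₀ one_pos)
  obtain ⟨L₀, hL₀⟩ := Filter.eventually_atTop.mp
    ((Real.tendsto_log_atTop.eventually_ge_atTop (2 / s)).and
      (HamSim.tendsto_div_log_atTop.eventually_ge_atTop 64))
  -- The maximum with 2 ensures ε₀ < 1/e.
  refine ⟨Real.exp (-max L₀ 2), Real.exp_pos _, Real.exp_lt_exp.mpr ?_, ?_⟩
  · linarith [le_max_right L₀ 2]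
  intro d h t ε hd hh ht hε hεle hτ
  have hL : max L₀ 2 ≤ Real.log (1 / ε) := by
    rw [one_div, Real.log_inv, le_neg, ← Real.log_exp (-max L₀ 2)]
    exact Real.log_le_log hε hεle
  obtain ⟨h1, h2⟩ := hL₀ _ ((le_max_left _ _).trans hL)
  have hε1 : ε < 1 := hεle.trans_lt (by simp)
  rcases le_total (d * h * t) (Real.log (1 / ε) / Real.log (Real.log (1 / ε))) with hle | hle
  · exact (HamSim.requiresQueries_precision hd hh ht hspos
      (by linarith [min_le_right τ₀ 1]) (by linarith [min_le_left τ₀ 1]) hε h1 h2).mono (by linarith)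
  · exact (HamSim.requiresQueries_time hd hh ht hε hε1 (h2.trans hle)).mono (by linarith)
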